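/- Let $\Sigma$ be a finite alphabet. A timed word over $\Sigma$ is a finite sequence $(t_1\cdot a_1)\cdots(t_n\cdot a_n)$ with delays $t_i\in\mathbb{R}_{\ge 0}$ and letters $a_i\in\Sigma$; a timed language is a set of timed words, and the residual of $L$ by $u$ is $u^{-1}L=\{w\mid uw\in L\}$. A one-clock timed automaton over $\Sigma$ has a finite set $Q$ of states, an initial state $q_I\in Q$, a set $F\subseteq Q$ of final states, and a finite set of transitions $(q,q',a,\phi,r)$ with $q,q'\in Q$, $a\in\Sigma$, $r\in\{0,1\}$ and a guard $\phi$ given by $\phi::= c<x\mid x=c\mid x<c\mid\phi\wedge\phi$ with $c\in\mathbb{N}$. A run starts in state $q_I$ with clock value $0$; reading $(t\cdot a)$ in state $q$ with clock value $\nu$, it takes a transition $(q,q',a,\phi,r)$ such that $\nu+t$ satisfies $\phi$, and moves to state $q'$ with clock value $(\nu+t)\cdot r$. A timed word is accepted if some run on it ends in a final state. The automaton is deterministic (a $1$-DTA) if any two distinct transitions with the same source and the same letter have guards that no clock value satisfies both. A timed language is $1$-DTA recognizable if it is the set of timed words accepted by some $1$-DTA. A timed word is half-integral if each of its delays is of the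 form $\frac m2$ with $m\in\mathbb{N}$; $\mathcal{HI}(L)$ denotes the set of half-integral words in $L$. The syntactic reset function $\mathbf{R}^L$ of a timed language $L$ maps timed words to non-negative reals and is defined inductively by $\mathbf{R}^L(\epsilon)=0$ and \[\mathbf{R}^L(u(t\cdot a))=\begin{cases}0&\text{if }(u(t\cdot a))^{-1}L\text{ is }1\text{-DTA recognizable},\\ \mathbf{R}^L(u)+t&\text{otherwise.}\end{cases}\] Theorem. If $L_1$ and $L_2$ are $1$-DTA recognizable timed languages over $\Sigma$, then $L_1=L_2$ if and only if $\mathcal{HI}(L_1)=\mathcal{HI}(L_2)$ and $\mathbf{R}^{L_1}=\mathbf{R}^{L_2}$. -/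

import Mathlib

open scoped NNReal

namespace OneClock

/-- A timed word `(t₁ · a₁) ⋯ (tₙ · aₙ)` over the alphabet `α`: a finite sequence of pairs of a delay
and a letter. -/
abbrev TimedWord (α : Type*) := List (ℝ≥0 × α)

/-- A timed language is a set of timed words. -/
abbrev TimedLanguage (α : Type*) := Set (TimedWord α)

/-- The residual language `u⁻¹L = {w | uw ∈ L}`. -/
def residual {α : Type*} (L : TimedLanguage α) (u : TimedWord α) : TimedLanguage α :=
  {w | u ++ w ∈ L}

/-- Clock constraints `φ ::= c < x | x = c | x < c | φ ∧ φ` with `c` a natural number. -/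
inductive ClockConstraint : Type
  | gt (c : ℕ) : ClockConstraint
  | eq (c : ℕ) : ClockConstraint
  | lt (c : ℕ) : ClockConstraint
  | and (φ ψ : ClockConstraint) : ClockConstraint

/-- The set of clock values that satisfy a clock constraint. -/
def ClockConstraint.sat : ClockConstraint → Set ℝ≥0
  | gt c => {x | (c : ℝ≥0) < x}
  | eq c => {x | x = (c : ℝ≥0)}
  | lt c => {x | x < (c : ℝ≥0)}
  | and φ ψ => φ.sat ∩ ψ.sat

/-- A transition with its source, target, letter, guard, and the information whether the clock is
reset (`reset = true`) or not (`reset = false`). -/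
structure Transition (Q α : Type*) where
  src : Q
  tgt : Q
  letter : α
  guard : ClockConstraint
  reset : Bool

/-- A one-clock timed automaton with state set `Q` over the alphabet `α`. The state set is required
to be finite where automata are used. -/
structure OneTA (Q α : Type*) where
  init : Q
  trans : Set (Transition Q α)
  finite_trans : trans.Finite
  final : Set Q

namespace OneTA

variable {Q α : Type*}

/-- Distinct transitions differ in their source or in their letter, or have disjoint guards. -/
def IsDeterministic (A : OneTA Q α) : Prop :=
  ∀ θ ∈ A.trans, ∀ θ' ∈ A.trans, θ ≠ θ' →
    θ.src ≠ θ'.src ∨ θ.letter ≠ θ'.letter ∨ θ.guard.sat ∩ θ'.guard.sat = ∅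

/-- `A.Reaches q ν w q' ν'`: there is a run of `A` on `w` from the configuration `(q, ν)` to the
configuration `(q', ν')`. -/
inductive Reaches (A : OneTA Q α) : Q → ℝ≥0 → TimedWord α → Q → ℝ≥0 → Prop
  | nil (q : Q) (ν : ℝ≥0) : Reaches A q ν [] q ν
  | cons (θ : Transition Q α) (ν t : ℝ≥0) (w : TimedWord α) (q' : Q) (ν' : ℝ≥0)
      (mem : θ ∈ A.trans) (sat : ν + t ∈ θ.guard.sat)
      (rest : Reaches A θ.tgt (if θ.reset = true then 0 else ν + t) w q' ν') :
      Reaches A θ.src ν ((t, θ.letter) :: w) q' ν'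

/-- The language of a configuration. -/
def langFrom (A : OneTA Q α) (q : Q) (ν : ℝ≥0) : TimedLanguage α :=
  {w | ∃ q' ∈ A.final, ∃ ν' : ℝ≥0, A.Reaches q ν w q' ν'}

/-- The language of an automaton, which is that of its initial configuration. -/
def lang (A : OneTA Q α) : TimedLanguage α :=
  A.langFrom A.init 0

end OneTA

/-- A timed language is 1-DTA recognizable if it is the language of a deterministic one-clock timed
automaton with finitely many states. -/
def IsOneDTARecognizable {α : Type*} (L : TimedLanguage α) : Prop :=
  ∃ (Q : Type) (_ : Finite Q) (A : OneTA Q α), A.IsDeterministic ∧ L = A.lang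

open Classical in
/-- The syntactic reset function of `L`, by recursion on prefixes; the two lemmas below are its
defining equations. -/
noncomputable def syntacticReset {α : Type*} (L : TimedLanguage α) (u : TimedWord α) : ℝ≥0 :=
  List.reverseRecOn (motive := fun _ => ℝ≥0) u 0
    (fun v p r => if IsOneDTARecognizable (residual L (v ++ [p])) then 0 else r + p.1)

theorem syntacticReset_nil {α : Type*} (L : TimedLanguage α) : syntacticReset L [] = 0 := by
  simp [syntacticReset]

open Classical in
theorem syntacticReset_append {α : Type*} (L : TimedLanguage α) (u : TimedWord α) (t : ℝ≥0)
    (a : α) :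
    syntacticReset L (u ++ [(t, a)]) =
      if IsOneDTARecognizable (residual L (u ++ [(t, a)])) then 0 else syntacticReset L u + t := by
  simp [syntacticReset]

/-- A timed word is half-integral if each of its delays is `m / 2` for some natural number `m`. -/
def IsHalfIntegral {α : Type*} (w : TimedWord α) : Prop :=
  ∀ p ∈ w, ∃ m : ℕ, p.1 = (m : ℝ≥0) / 2

/-- The set of half-integral words of a language. -/
def halfIntegralWords {α : Type*} (L : TimedLanguage α) : Set (TimedWord α) :=
  {w | w ∈ L ∧ IsHalfIntegral w}

end OneClock

/-!
For a state `q` of a deterministic automaton, write `F ν` for the language of the configuration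
`(q, ν)`. Suppose that `F x` is also the language of a configuration whose clock value differs from
`x` by a non-integer. After any first delay at least one of the two clocks is not an integer, so
small changes of the delay keep that clock in its region, and by induction on the length of the
word they do not affect membership. By connectedness membership does not depend on the first delay
at all, and it follows that `F` is constant on the region of `x`. A recognizable language is that of
a configuration with clock value zero. Therefore, if `F x` is recognizable, then `F` is constant on
the region of `x`.

Hence the syntactic reset behaves like an actual clock: two words that lead to the same state at
syntactic clock values in the same region continue to do so when they are extended by the same
letter after delays that reach the same region. Every region contains a half-integer, so every
word has a half-integral companion with this property, and languages with the same syntactic reset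
function admit a common companion.
-/

namespace OneClock

open scoped Topology

section Region

variable {x y : ℝ≥0}

/-- The index of the region of a clock value: `2 * n` for the value `n`, and `2 * n + 1` for the
values strictly between `n` and `n + 1`. Values with the same index satisfy the same clock
constraints. -/
noncomputable def region (x : ℝ≥0) : ℕ := ⌊x⌋₊ + ⌈x⌉₊

theorem region_mono : Monotone region := Nat.floor_mono.add Nat.ceil_mono

theorem region_lt_two_mul {n : ℕ} : region x < 2 * n ↔ x < n := by
  have h₁ := Nat.floor_le_ceil x
  have h₂ := Nat.ceil_le_floor_add_one x
  rw [region, ← Nat.floor_lt zero_le]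
  omega

theorem two_mul_lt_region {n : ℕ} : 2 * n < region x ↔ n < x := by
  have h₁ := Nat.floor_le_ceil x
  have h₂ := Nat.ceil_le_floor_add_one x
  rw [region, ← Nat.lt_ceil]
  omega

theorem region_eq_two_mul {n : ℕ} : region x = 2 * n ↔ x = n := by
  rw [le_antisymm_iff, le_antisymm_iff, ← not_lt, ← not_lt, two_mul_lt_region, region_lt_two_mul,
    not_lt, not_lt]

theorem region_natCast_div_two (k : ℕ) : region ((k : ℝ≥0) / 2) = k := by
  have lt_iff (n : ℕ) : region ((k : ℝ≥0) / 2) < 2 * n ↔ k < 2 * n := by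
    rw [region_lt_two_mul, div_lt_iff₀' two_pos]
    norm_cast
  have gt_iff (n : ℕ) : 2 * n < region ((k : ℝ≥0) / 2) ↔ 2 * n < k := by
    rw [two_mul_lt_region, lt_div_iff₀' two_pos]
    norm_cast
  have := lt_iff (k / 2)
  have := gt_iff (k / 2)
  have := lt_iff (k / 2 + 1)
  omega

theorem fract_eq_zero_iff_exists_natCast : Int.fract (x : ℝ) = 0 ↔ ∃ n : ℕ, x = n := by
  constructor
  · intro h
    obtain ⟨z, hz⟩ := Int.fract_eq_zero_iff.1 h
    have hz_nonneg : 0 ≤ z := Int.cast_nonneg_iff.1 (hz.trans_ge x.2)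
    lift z to ℕ using hz_nonneg
    exact ⟨z, NNReal.eq (by simpa using hz.symm)⟩
  · rintro ⟨n, rfl⟩
    simp

theorem eq_of_region_eq_of_fract_eq_zero (h : region y = region x) (hx : Int.fract (x : ℝ) = 0) :
    y = x := by
  obtain ⟨n, rfl⟩ := fract_eq_zero_iff_exists_natCast.1 hx
  exact region_eq_two_mul.1 (h.trans (region_eq_two_mul.2 rfl))

theorem eventually_region_eq (hx : Int.fract (x : ℝ) ≠ 0) : ∀ᶠ y in 𝓝 x, region y = region x := by
  obtain ⟨n, hn | hn⟩ := (region x).even_or_odd'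
  · exact absurd (fract_eq_zero_iff_exists_natCast.2 ⟨n, region_eq_two_mul.1 hn⟩) hx
  have lower : (n : ℝ≥0) < x := two_mul_lt_region.1 (by omega)
  have upper : x < (n + 1 : ℕ) := region_lt_two_mul.1 (by omega)
  filter_upwards [Ioo_mem_nhds lower upper] with y hy
  have := two_mul_lt_region.2 hy.1
  have := region_lt_two_mul.2 hy.2
  omega

theorem fract_add_right_ne (h : Int.fract (x : ℝ) ≠ Int.fract (y : ℝ)) (t : ℝ≥0) :
    Int.fract ((x + t : ℝ≥0) : ℝ) ≠ Int.fract ((y + t : ℝ≥0) : ℝ) := by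
  rwa [Ne, Int.fract_eq_fract, NNReal.coe_add, NNReal.coe_add, add_sub_add_right_eq_sub,
    ← Int.fract_eq_fract]

theorem exists_region_half_add_half_eq (x t : ℝ≥0) :
    ∃ m : ℕ, region ((region x : ℝ≥0) / 2 + (m : ℝ≥0) / 2) = region (x + t) := by
  obtain ⟨m, hm⟩ := Nat.exists_eq_add_of_le (region_mono (le_self_add : x ≤ x + t))
  refine ⟨m, ?_⟩
  rw [hm, ← add_div, ← Nat.cast_add, region_natCast_div_two]

theorem ClockConstraint.mem_sat_congr (h : region x = region y) (φ : ClockConstraint) :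
    x ∈ φ.sat ↔ y ∈ φ.sat := by
  induction φ with
  | gt c => exact two_mul_lt_region.symm.trans (h ▸ two_mul_lt_region)
  | eq c => exact region_eq_two_mul.symm.trans (h ▸ region_eq_two_mul)
  | lt c => exact region_lt_two_mul.symm.trans (h ▸ region_lt_two_mul)
  | and φ ψ hφ hψ => exact and_congr hφ hψ

end Region

namespace OneTA

variable {Q α : Type*} {A : OneTA Q α}

theorem nil_mem_langFrom {q : Q} {ν : ℝ≥0} : [] ∈ A.langFrom q ν ↔ q ∈ A.final := by
  constructor
  · rintro ⟨_, hq, _, ⟨⟩⟩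
    exact hq
  · exact fun hq => ⟨q, hq, ν, .nil q ν⟩

theorem cons_mem_langFrom {t ν : ℝ≥0} {a : α} {w : TimedWord α} {q : Q} :
    (t, a) :: w ∈ A.langFrom q ν ↔
      ∃ θ ∈ A.trans, θ.src = q ∧ θ.letter = a ∧ ν + t ∈ θ.guard.sat ∧
        w ∈ A.langFrom θ.tgt (if θ.reset = true then 0 else ν + t) := by
  constructor
  · rintro ⟨q', hq', ν', run⟩
    cases run with
    | cons θ _ _ _ _ _ mem sat rest => exact ⟨θ, mem, rfl, rfl, sat, q', hq', ν', rest⟩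
  · rintro ⟨θ, mem, rfl, rfl, sat, q', hq', ν', rest⟩
    exact ⟨q', hq', ν', .cons θ _ _ _ _ _ mem sat rest⟩

theorem langFrom_withInit (q₀ q : Q) (ν : ℝ≥0) :
    { A with init := q₀ }.langFrom q ν = A.langFrom q ν := by
  ext w
  induction w generalizing q ν with
  | nil => simp only [nil_mem_langFrom]
  | cons p w ih =>
    obtain ⟨t, a⟩ := p
    simp only [cons_mem_langFrom, ih]

theorem IsDeterministic.residual_langFrom (hA : A.IsDeterministic) {θ : Transition Q α}
    (hθ : θ ∈ A.trans) {t ν : ℝ≥0} (hsat : ν + t ∈ θ.guard.sat) :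
    residual (A.langFrom θ.src ν) [(t, θ.letter)] =
      A.langFrom θ.tgt (if θ.reset = true then 0 else ν + t) := by
  ext w
  refine cons_mem_langFrom.trans ⟨?_, fun hw => ⟨θ, hθ, rfl, rfl, hsat, hw⟩⟩
  rintro ⟨θ', hθ', hsrc, hletter, hsat', hw⟩
  suffices θ' = θ by rwa [← this]
  by_contra hne
  rcases hA θ' hθ' θ hθ hne with h | h | h
  · exact h hsrc
  · exact h hletter
  · exact Set.eq_empty_iff_forall_notMem.1 h _ ⟨hsat', hsat⟩

end OneTA

variable {α : Type*} {L L₁ L₂ : TimedLanguage α} {F G : ℝ≥0 → TimedLanguage α} {x y : ℝ≥0}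
  {u v w : TimedWord α}

/-- A family of timed languages indexed by clock values is a state family if its members are the
languages of the configurations `(q, ν)`, for `ν` a clock value, of one fixed state `q` of a
deterministic one-clock timed automaton. It stands for that state independently of the
automaton. -/
def IsStateFamily (F : ℝ≥0 → TimedLanguage α) : Prop :=
  ∃ (Q : Type) (_ : Finite Q) (A : OneTA Q α) (q : Q), A.IsDeterministic ∧ F = A.langFrom q

theorem isOneDTARecognizable_iff_exists_isStateFamily :
    IsOneDTARecognizable L ↔ ∃ F, IsStateFamily F ∧ L = F 0 := by
  constructor
  · rintro ⟨Q, hQ, A, hA, rfl⟩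
    exact ⟨_, ⟨Q, hQ, A, A.init, hA, rfl⟩, rfl⟩
  · rintro ⟨_, ⟨Q, hQ, A, q, hA, rfl⟩, rfl⟩
    exact ⟨Q, hQ, { A with init := q }, hA, (OneTA.langFrom_withInit q q 0).symm⟩

theorem isStateFamily_empty : IsStateFamily fun _ => (∅ : TimedLanguage α) :=
  ⟨Unit, inferInstance, ⟨(), ∅, Set.finite_empty, ∅⟩, (), fun _ h => h.elim,
    funext fun _ => (Set.eq_empty_iff_forall_notMem.2 (by rintro _ ⟨_, h, _⟩; exact h)).symm⟩

namespace IsStateFamily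

theorem isOneDTARecognizable (hF : IsStateFamily F) : IsOneDTARecognizable (F 0) :=
  isOneDTARecognizable_iff_exists_isStateFamily.2 ⟨F, hF, rfl⟩

theorem nil_mem_congr (hF : IsStateFamily F) (x y : ℝ≥0) : [] ∈ F x ↔ [] ∈ F y := by
  obtain ⟨Q, _, A, q, -, rfl⟩ := hF
  rw [OneTA.nil_mem_langFrom, OneTA.nil_mem_langFrom]

theorem exists_successor (hF : IsStateFamily F) (x : ℝ≥0) (a : α) :
    ∃ G, IsStateFamily G ∧
      ((∀ ν t, region (ν + t) = region x → residual (F ν) [(t, a)] = G 0) ∨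
        ∀ ν t, region (ν + t) = region x → residual (F ν) [(t, a)] = G (ν + t)) := by
  obtain ⟨Q, hQ, A, q, hA, rfl⟩ := hF
  by_cases enabled : ∃ θ ∈ A.trans, θ.src = q ∧ θ.letter = a ∧ x ∈ θ.guard.sat
  · obtain ⟨θ, hθ, rfl, rfl, hx⟩ := enabled
    have residual_eq (ν t : ℝ≥0) (h : region (ν + t) = region x) :
        residual (A.langFrom θ.src ν) [(t, θ.letter)] =
          A.langFrom θ.tgt (if θ.reset = true then 0 else ν + t) :=
      hA.residual_langFrom hθ ((θ.guard.mem_sat_congr h).2 hx)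
    refine ⟨A.langFrom θ.tgt, ⟨Q, hQ, A, θ.tgt, hA, rfl⟩, ?_⟩
    cases hreset : θ.reset with
    | true => exact .inl (by simpa only [hreset, if_true] using residual_eq)
    | false => exact .inr (by simpa only [hreset, Bool.false_eq_true, if_false] using residual_eq)
  · refine ⟨_, isStateFamily_empty, .inl fun ν t h => ?_⟩
    refine Set.eq_empty_iff_forall_notMem.2 fun w hw => ?_
    obtain ⟨θ, hθ, hsrc, hletter, hsat, -⟩ := OneTA.cons_mem_langFrom.1 hw
    exact enabled ⟨θ, hθ, hsrc, hletter, (θ.guard.mem_sat_congr h).1 hsat⟩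

end IsStateFamily

/-- The language `F x` is ambiguous if it is also the language of a configuration whose clock value
does not differ from `x` by an integer, so that it does not reveal the fractional part of `x`. -/
def IsAmbiguous (F : ℝ≥0 → TimedLanguage α) (x : ℝ≥0) : Prop :=
  ∃ G, ∃ y : ℝ≥0, IsStateFamily G ∧ Int.fract (x : ℝ) ≠ Int.fract (y : ℝ) ∧ F x = G y

namespace IsAmbiguous

theorem of_isOneDTARecognizable (h : IsOneDTARecognizable (F x)) (hx : Int.fract (x : ℝ) ≠ 0) :
    IsAmbiguous F x := by
  obtain ⟨G, hG, hFG⟩ := isOneDTARecognizable_iff_exists_isStateFamily.1 h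
  exact ⟨G, 0, hG, by simpa using hx, hFG⟩

theorem successor (h : IsAmbiguous F x) {t : ℝ≥0} {a : α}
    (ht : Int.fract ((x + t : ℝ≥0) : ℝ) ≠ 0) (hG : residual (F x) [(t, a)] = G (x + t)) :
    IsAmbiguous G (x + t) := by
  obtain ⟨F', y, hF', hxy, hFF'⟩ := h
  rw [hFF'] at hG
  obtain ⟨G', hG', reset | no_reset⟩ := hF'.exists_successor (y + t) a
  · exact ⟨G', 0, hG', by simpa using ht, hG.symm.trans (reset y t rfl)⟩
  · exact ⟨G', y + t, hG', fract_add_right_ne hxy t, hG.symm.trans (no_reset y t rfl)⟩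

end IsAmbiguous

/-- Membership of `w` in the language of a configuration depends only on the state and the region
of the clock value, wherever that language is ambiguous. This is the property of `w` that is
proved by induction. -/
def IsRegionInvariant (w : TimedWord α) : Prop :=
  ∀ ⦃F⦄, IsStateFamily F → ∀ ⦃x⦄, IsAmbiguous F x → ∀ ⦃z⦄, region z = region x →
    (w ∈ F z ↔ w ∈ F x)

namespace IsRegionInvariant

theorem cons_mem_congr (hw : IsRegionInvariant w) (hF : IsStateFamily F) (hx : IsAmbiguous F x)
    (a : α) {t t' z : ℝ≥0} (h : region (z + t') = region (x + t)) :
    (t', a) :: w ∈ F z ↔ (t, a) :: w ∈ F x := by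
  change w ∈ residual (F z) [(t', a)] ↔ w ∈ residual (F x) [(t, a)]
  obtain ⟨G, hG, reset | no_reset⟩ := hF.exists_successor (x + t) a
  · rw [reset z t' h, reset x t rfl]
  · rw [no_reset z t' h, no_reset x t rfl]
    by_cases ht : Int.fract ((x + t : ℝ≥0) : ℝ) = 0
    · rw [eq_of_region_eq_of_fract_eq_zero h ht]
    · exact hw hG (hx.successor ht (no_reset x t rfl)) h

theorem eventually_cons_mem_congr (hw : IsRegionInvariant w) (hF : IsStateFamily F)
    (hx : IsAmbiguous F x) (a : α) {t : ℝ≥0} (ht : Int.fract ((x + t : ℝ≥0) : ℝ) ≠ 0) :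
    ∀ᶠ t' in 𝓝 t, (t', a) :: w ∈ F x ↔ (t, a) :: w ∈ F x :=
  (((continuous_const_add x).tendsto t).eventually (eventually_region_eq ht)).mono
    fun _ => hw.cons_mem_congr hF hx a

theorem cons_mem_iff (hw : IsRegionInvariant w) (hF : IsStateFamily F) (hx : IsAmbiguous F x)
    (a : α) (t t' : ℝ≥0) : (t, a) :: w ∈ F x ↔ (t', a) :: w ∈ F x := by
  obtain ⟨G, y, hG, hxy, hFG⟩ := id hx
  have hy : IsAmbiguous G y := ⟨F, x, hF, hxy.symm, hFG.symm⟩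
  have locally_constant : IsLocallyConstant fun t => (t, a) :: w ∈ F x := by
    refine (IsLocallyConstant.iff_eventually_eq _).2 fun t => ?_
    simp only [eq_iff_iff]
    by_cases ht : Int.fract ((x + t : ℝ≥0) : ℝ) = 0
    · have ht' : Int.fract ((y + t : ℝ≥0) : ℝ) ≠ 0 := ht ▸ (fract_add_right_ne hxy t).symm
      exact hFG ▸ hw.eventually_cons_mem_congr hG hy a ht'
    · exact hw.eventually_cons_mem_congr hF hx a ht
  exact iff_of_eq (locally_constant.apply_eq_of_preconnectedSpace t t')

end IsRegionInvariant

theorem isRegionInvariant (w : TimedWord α) : IsRegionInvariant w := by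
  induction w with
  | nil => exact fun _ hF x _ z _ => hF.nil_mem_congr z x
  | cons p w hw =>
    obtain ⟨t, a⟩ := p
    intro F hF x hx z hz
    obtain ⟨t', ht'⟩ : ∃ t', region (z + t) = region (x + t') := by
      rcases le_total x (z + t) with h | h
      · obtain ⟨t', ht'⟩ := exists_add_of_le h
        exact ⟨t', congrArg region ht'⟩
      · exact ⟨0, by simpa using (region_mono h).antisymm (hz ▸ region_mono le_self_add)⟩
    exact (hw.cons_mem_congr hF hx a ht').trans (hw.cons_mem_iff hF hx a t' t)

theorem IsStateFamily.eq_of_region_eq (hF : IsStateFamily F) (hx : IsOneDTARecognizable (F x))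
    (h : region y = region x) : F y = F x := by
  by_cases hfract : Int.fract (x : ℝ) = 0
  · rw [eq_of_region_eq_of_fract_eq_zero h hfract]
  · have ambiguous := IsAmbiguous.of_isOneDTARecognizable hx hfract
    exact Set.ext fun w => isRegionInvariant w hF ambiguous h

theorem residual_append (L : TimedLanguage α) (u v : TimedWord α) :
    residual L (u ++ v) = residual (residual L u) v := by
  simp only [residual, List.append_assoc, Set.mem_ofPred_eq]

theorem nil_mem_residual : [] ∈ residual L u ↔ u ∈ L := by
  simp only [residual, List.append_nil, Set.mem_ofPred_eq]

/-- Two words are companions for `L` if they lead to one state of a deterministic automaton, at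
the clock values given by the syntactic reset function of `L`, which lie in the same region. -/
def AreCompanions (L : TimedLanguage α) (u v : TimedWord α) : Prop :=
  region (syntacticReset L u) = region (syntacticReset L v) ∧
    ∃ F, IsStateFamily F ∧ residual L u = F (syntacticReset L u) ∧
      residual L v = F (syntacticReset L v)

namespace AreCompanions

theorem nil (hL : IsOneDTARecognizable L) : AreCompanions L [] [] := by
  obtain ⟨F, hF, rfl⟩ := isOneDTARecognizable_iff_exists_isStateFamily.1 hL
  exact ⟨rfl, F, hF, by rw [syntacticReset_nil]; rfl, by rw [syntacticReset_nil]; rfl⟩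

theorem mem_iff (h : AreCompanions L u v) : u ∈ L ↔ v ∈ L := by
  obtain ⟨-, F, hF, hu, hv⟩ := h
  rw [← nil_mem_residual, ← nil_mem_residual (u := v), hu, hv]
  exact hF.nil_mem_congr _ _

theorem of_residual_eq {t t' : ℝ≥0} {a b : α}
    (hu : IsOneDTARecognizable (residual L (u ++ [(t, a)])))
    (h : residual L (v ++ [(t', b)]) = residual L (u ++ [(t, a)])) :
    AreCompanions L (u ++ [(t, a)]) (v ++ [(t', b)]) := by
  obtain ⟨F, hF, hFu⟩ := isOneDTARecognizable_iff_exists_isStateFamily.1 hu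
  rw [AreCompanions, syntacticReset_append, syntacticReset_append, if_pos hu, if_pos (h ▸ hu)]
  exact ⟨rfl, F, hF, hFu, h.trans hFu⟩

theorem of_not_isOneDTARecognizable {t t' : ℝ≥0} {a b : α} (hF : IsStateFamily F)
    (hu : residual L (u ++ [(t, a)]) = F (syntacticReset L u + t))
    (hv : residual L (v ++ [(t', b)]) = F (syntacticReset L v + t'))
    (hu_not : ¬ IsOneDTARecognizable (residual L (u ++ [(t, a)])))
    (hregion : region (syntacticReset L v + t') = region (syntacticReset L u + t)) :
    AreCompanions L (u ++ [(t, a)]) (v ++ [(t', b)]) := by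
  have hv_not : ¬ IsOneDTARecognizable (residual L (v ++ [(t', b)])) := fun h => by
    rw [hv] at h
    exact hu_not (by rwa [hu, hF.eq_of_region_eq h hregion.symm])
  rw [AreCompanions, syntacticReset_append, syntacticReset_append, if_neg hu_not, if_neg hv_not]
  exact ⟨hregion.symm, F, hF, hu, hv⟩

theorem append (h : AreCompanions L u v) {t t' : ℝ≥0} (a : α)
    (hregion : region (syntacticReset L v + t') = region (syntacticReset L u + t)) :
    AreCompanions L (u ++ [(t, a)]) (v ++ [(t', a)]) := by
  obtain ⟨-, F, hF, hu, hv⟩ := h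
  obtain ⟨G, hG, reset | no_reset⟩ := hF.exists_successor (syntacticReset L u + t) a
  · have hu' : residual L (u ++ [(t, a)]) = G 0 := by
      rw [residual_append, hu, reset _ _ rfl]
    have hv' : residual L (v ++ [(t', a)]) = G 0 := by
      rw [residual_append, hv, reset _ _ hregion]
    exact of_residual_eq (hu' ▸ hG.isOneDTARecognizable) (hv'.trans hu'.symm)
  · have hu' : residual L (u ++ [(t, a)]) = G (syntacticReset L u + t) := by
      rw [residual_append, hu, no_reset _ _ rfl]
    have hv' : residual L (v ++ [(t', a)]) = G (syntacticReset L v + t') := by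
      rw [residual_append, hv, no_reset _ _ hregion]
    by_cases hrec : IsOneDTARecognizable (residual L (u ++ [(t, a)]))
    · have hGeq := hG.eq_of_region_eq (hu' ▸ hrec) hregion
      exact of_residual_eq hrec (hv'.trans (hGeq.trans hu'.symm))
    · exact of_not_isOneDTARecognizable hG hu' hv' hrec hregion

end AreCompanions

theorem IsHalfIntegral.append (hu : IsHalfIntegral u) (hv : IsHalfIntegral v) :
    IsHalfIntegral (u ++ v) := fun p hp => (List.mem_append.1 hp).elim (hu p) (hv p)

theorem IsHalfIntegral.exists_syntacticReset_eq (hv : IsHalfIntegral v) (L : TimedLanguage α) :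
    ∃ k : ℕ, syntacticReset L v = (k : ℝ≥0) / 2 := by
  induction v using List.reverseRecOn with
  | nil => exact ⟨0, by simp [syntacticReset_nil]⟩
  | append_singleton v p ih =>
    obtain ⟨t, a⟩ := p
    obtain ⟨k, hk⟩ := ih fun p hp => hv p (List.mem_append_left _ hp)
    obtain ⟨m, rfl⟩ : ∃ m : ℕ, t = (m : ℝ≥0) / 2 := hv (t, a) (by simp)
    rw [syntacticReset_append]
    split_ifs
    · exact ⟨0, by simp⟩
    · exact ⟨k + m, by rw [hk, Nat.cast_add, add_div]⟩

theorem exists_isHalfIntegral_areCompanions (h₁ : IsOneDTARecognizable L₁)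
    (h₂ : IsOneDTARecognizable L₂) (hR : syntacticReset L₁ = syntacticReset L₂)
    (u : TimedWord α) :
    ∃ v, IsHalfIntegral v ∧ AreCompanions L₁ u v ∧ AreCompanions L₂ u v := by
  induction u using List.reverseRecOn with
  | nil => exact ⟨[], by simp [IsHalfIntegral], .nil h₁, .nil h₂⟩
  | append_singleton u p ih =>
    obtain ⟨t, a⟩ := p
    obtain ⟨v, hv, hc₁, hc₂⟩ := ih
    obtain ⟨k, hk⟩ := hv.exists_syntacticReset_eq L₁
    have hregion : region (syntacticReset L₁ u) = k := by
      rw [hc₁.1, hk, region_natCast_div_two]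
    obtain ⟨m, hm⟩ := exists_region_half_add_half_eq (syntacticReset L₁ u) t
    rw [hregion, ← hk] at hm
    have half_delay : IsHalfIntegral [((m : ℝ≥0) / 2, a)] := by simp [IsHalfIntegral]
    exact ⟨v ++ [((m : ℝ≥0) / 2, a)], hv.append half_delay, hc₁.append a hm,
      hc₂.append a (hR ▸ hm)⟩

theorem mem_iff_of_halfIntegralWords_eq (h : halfIntegralWords L₁ = halfIntegralWords L₂)
    (hv : IsHalfIntegral v) : v ∈ L₁ ↔ v ∈ L₂ := by
  simpa only [halfIntegralWords, Set.mem_ofPred_eq, hv, and_true] using Set.ext_iff.1 h v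

end OneClock

theorem theorem2_general {α : Type*} (L₁ L₂ : OneClock.TimedLanguage α)
    (h₁ : OneClock.IsOneDTARecognizable L₁) (h₂ : OneClock.IsOneDTARecognizable L₂) :
    L₁ = L₂ ↔
      OneClock.halfIntegralWords L₁ = OneClock.halfIntegralWords L₂ ∧
        OneClock.syntacticReset L₁ = OneClock.syntacticReset L₂ := by
  refine ⟨fun h => h ▸ ⟨rfl, rfl⟩, fun ⟨hHI, hR⟩ => Set.ext fun u => ?_⟩
  obtain ⟨v, hv, hc₁, hc₂⟩ := OneClock.exists_isHalfIntegral_areCompanions h₁ h₂ hR u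
  calc
    u ∈ L₁ ↔ v ∈ L₁ := hc₁.mem_iff
    _ ↔ v ∈ L₂ := OneClock.mem_iff_of_halfIntegralWords_eq hHI hv
    _ ↔ u ∈ L₂ := hc₂.mem_iff.symm

theorem theorem2 {α : Type*} [Finite α] (L₁ L₂ : OneClock.TimedLanguage α)
    (h₁ : OneClock.IsOneDTARecognizable L₁) (h₂ : OneClock.IsOneDTARecognizable L₂) :
    L₁ = L₂ ↔
      OneClock.halfIntegralWords L₁ = OneClock.halfIntegralWords L₂ ∧
        OneClock.syntacticReset L₁ = OneClock.syntacticReset L₂ :=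
  theorem2_general L₁ L₂ h₁ h₂
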